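/- Let $l^\infty(\mathbb{N})$ be the C*-algebra of bounded functions $f:\mathbb{N}\to\mathbb{C}$, $\mathbb{N}=\{0,1,2,\dots\}$, and put $(\sigma f)(n)=f(n+1)$. For $f\in l^\infty(\mathbb{N})$ let $\mathcal{A}_f$ be the smallest unital C*-subalgebra of $l^\infty(\mathbb{N})$ that contains $f$ and is invariant under $\sigma$, let $X_f$ be its maximal ideal space (the space of multiplicative states with the weak* topology), and let $A$ be the continuous self-map of $X_f$ given by $(A\rho)(g)=\rho(\sigma g)$, which is the unique continuous extension of $\iota(n)\mapsto\iota(n+1)$, where $\iota(n)$ is evaluation at $n$. The anqie entropy of $f$ is the topological entropy of $A$ (defined through open covers). Let $\mathcal{E}_0(\mathbb{N})$ be the set of all $f\in l^\infty(\mathbb{N})$ with zero anqie entropy; it is a unital C*-subalgebra of $l^\infty(\mathbb{N})$. For a unital C*-algebra $\mathcal{A}$ let $\mathcal{U}_k(\mathcal{A})$ be the unitary group of $M_k(\mathcal{A})$, and for $u,v\in\mathcal{U}_k(\mathcal{A})$ write $u\sim_h v$ if there is a norm-continuous path in $\mathcal{U}_k(\mathcal{A})$ from $u$ to $v$. Let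 $K_1(\mathcal{A})$ be the disjoint union $\bigsqcup_{k\ge1}\mathcal{U}_k(\mathcal{A})$ modulo the equivalence relation under which $u\in\mathcal{U}_n(\mathcal{A})$ and $v\in\mathcal{U}_m(\mathcal{A})$ are equivalent if $\operatorname{diag}(u,1_{k-n})\sim_h\operatorname{diag}(v,1_{k-m})$ for some $k\ge\max\{n,m\}$. **Theorem.** The group $K_1(\mathcal{E}_0(\mathbb{N}))$ is trivial. Moreover, for every $k$ and every $u\in\mathcal{U}_k(\mathcal{E}_0(\mathbb{N}))$ one has $u\sim_h I_k$ in $\mathcal{U}_k(\mathcal{E}_0(\mathbb{N}))$. -/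

import Mathlib

open Filter Topology Set
open scoped ENNReal Uniformity

section TopologicalEntropy

variable {X Y : Type*}

/-- A family `𝒰` of subsets of `X` is an open cover of `X`. -/
def IsOpenCovering [TopologicalSpace X] (𝒰 : Set (Set X)) : Prop :=
  (∀ U ∈ 𝒰, IsOpen U) ∧ ⋃₀ 𝒰 = univ

/-- The least number of members of `𝒰` that cover `X`. It is only used for families that have a
finite subcover. -/
noncomputable def coverNumber (𝒰 : Set (Set X)) : ℕ :=
  sInf {k : ℕ | ∃ s : Finset (Set X), (s : Set (Set X)) ⊆ 𝒰 ∧ ⋃₀ (s : Set (Set X)) = univ ∧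
    s.card = k}

/-- The cover `𝒰 ∨ T⁻¹𝒰 ∨ ⋯ ∨ T⁻ⁿ⁺¹𝒰`. -/
def iterJoin (T : X → X) (𝒰 : Set (Set X)) (n : ℕ) : Set (Set X) :=
  {W | ∃ φ : Fin n → Set X, (∀ i, φ i ∈ 𝒰) ∧ W = ⋂ i : Fin n, T^[(i : ℕ)] ⁻¹' (φ i)}

/-- `h(T, 𝒰) = lim (1/n) log 𝒩(𝒰 ∨ T⁻¹𝒰 ∨ ⋯ ∨ T⁻ⁿ⁺¹𝒰)`. For a continuous map of a compact space
and an open cover the limit exists by subadditivity, so it is the `limsup`. -/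
noncomputable def coverEntropyOf (T : X → X) (𝒰 : Set (Set X)) : EReal :=
  limsup (fun n : ℕ => ((Real.log (coverNumber (iterJoin T 𝒰 n)) / n : ℝ) : EReal)) atTop

/-- The topological entropy of a map of a compact space. -/
noncomputable def topEntropy [TopologicalSpace X] (T : X → X) : EReal :=
  ⨆ 𝒰 : {𝒰 : Set (Set X) // IsOpenCovering 𝒰}, coverEntropyOf T 𝒰.1

/-- `𝒰` has a finite subcover. -/
def FinCov (𝒰 : Set (Set X)) : Prop :=
  ∃ s : Finset (Set X), (s : Set (Set X)) ⊆ 𝒰 ∧ ⋃₀ (s : Set (Set X)) = univ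

lemma FinCov.exists_card {𝒰 : Set (Set X)} (h : FinCov 𝒰) :
    ∃ s : Finset (Set X), (s : Set (Set X)) ⊆ 𝒰 ∧ ⋃₀ (s : Set (Set X)) = univ ∧
      s.card = coverNumber 𝒰 := by
  obtain ⟨s, h1, h2⟩ := h
  exact Nat.sInf_mem (s := {k : ℕ | ∃ s : Finset (Set X), (s : Set (Set X)) ⊆ 𝒰 ∧
    ⋃₀ (s : Set (Set X)) = univ ∧ s.card = k}) ⟨_, s, h1, h2, rfl⟩

lemma coverNumber_le_card {𝒰 : Set (Set X)} {s : Finset (Set X)} (h1 : (s : Set (Set X)) ⊆ 𝒰)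
    (h2 : ⋃₀ (s : Set (Set X)) = univ) : coverNumber 𝒰 ≤ s.card :=
  Nat.sInf_le ⟨s, h1, h2, rfl⟩

lemma coverNumber_le_of_index {𝒰 : Set (Set X)} {ι : Type*} (s : Finset ι) (f : ι → Set X)
    (h1 : ∀ i ∈ s, f i ∈ 𝒰) (h2 : ∀ x, ∃ i ∈ s, x ∈ f i) : coverNumber 𝒰 ≤ s.card := by
  classical
  refine (coverNumber_le_card (s := s.image f) ?_ ?_).trans Finset.card_image_le
  · intro W hW
    obtain ⟨i, hi, rfl⟩ := Finset.mem_image.1 hW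
    exact h1 i hi
  · refine eq_univ_of_forall fun x => ?_
    obtain ⟨i, hi, hx⟩ := h2 x
    exact ⟨f i, by simpa using ⟨i, hi, rfl⟩, hx⟩

lemma FinCov.exists_mem {s : Set (Set X)} (h : ⋃₀ s = univ) (x : X) : ∃ W ∈ s, x ∈ W := by
  have : x ∈ ⋃₀ s := h ▸ mem_univ x
  exact this

lemma coverNumber_le_of_refine {𝒰 𝒱 : Set (Set X)} (hV : FinCov 𝒱)
    (h : ∀ V ∈ 𝒱, ∃ U ∈ 𝒰, V ⊆ U) : coverNumber 𝒰 ≤ coverNumber 𝒱 := by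
  obtain ⟨s, h1, h2, h3⟩ := hV.exists_card
  choose! f hf using h
  rw [← h3]
  refine coverNumber_le_of_index s f (fun V hV => (hf V (h1 hV)).1) fun x => ?_
  obtain ⟨V, hV, hx⟩ := FinCov.exists_mem h2 x
  exact ⟨V, hV, (hf V (h1 hV)).2 hx⟩

lemma iterJoin_isOpenCover [TopologicalSpace X] {T : X → X} (hT : Continuous T)
    {𝒰 : Set (Set X)} (h : IsOpenCovering 𝒰) (n : ℕ) : IsOpenCovering (iterJoin T 𝒰 n) := by
  refine ⟨?_, eq_univ_of_forall fun x => ?_⟩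
  · rintro W ⟨φ, hφ, rfl⟩
    exact isOpen_iInter_of_finite fun i => (h.1 _ (hφ i)).preimage (hT.iterate i)
  · choose φ hφ hx using fun i : Fin n => FinCov.exists_mem h.2 (T^[i] x)
    exact ⟨_, ⟨φ, hφ, rfl⟩, mem_iInter.2 hx⟩

lemma IsOpenCovering.finCov [TopologicalSpace X] [CompactSpace X] {𝒰 : Set (Set X)}
    (h : IsOpenCovering 𝒰) : FinCov 𝒰 := by
  obtain ⟨t, ht⟩ := isCompact_univ.elim_finite_subcover (fun U : 𝒰 => (U : Set X))
    (fun U => h.1 U U.2) (by rw [← sUnion_eq_iUnion, h.2])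
  classical
  refine ⟨t.image (fun U : 𝒰 => (U : Set X)), ?_, eq_univ_of_forall fun x => ?_⟩
  · intro W hW
    obtain ⟨U, -, rfl⟩ := Finset.mem_image.1 (Finset.mem_coe.1 hW)
    exact U.2
  · obtain ⟨U, hU, hx⟩ := mem_iUnion₂.1 (ht (mem_univ x))
    exact ⟨U, Finset.mem_coe.2 (Finset.mem_image.2 ⟨U, hU, rfl⟩), hx⟩

lemma coverEntropyOf_mono {T : X → X} {S : Y → Y} {𝒰 : Set (Set X)} {𝒱 : Set (Set Y)}
    (h : ∀ n, coverNumber (iterJoin T 𝒰 n) ≤ coverNumber (iterJoin S 𝒱 n)) :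
    coverEntropyOf T 𝒰 ≤ coverEntropyOf S 𝒱 := by
  refine limsup_le_limsup (Eventually.of_forall fun n => ?_)
  rw [EReal.coe_le_coe_iff]
  rcases Nat.eq_zero_or_pos (coverNumber (iterJoin T 𝒰 n)) with h0 | h0
  · rw [h0]
    simpa using div_nonneg (Real.log_natCast_nonneg _) (Nat.cast_nonneg n)
  · gcongr
    exact h n

lemma coverEntropyOf_le [TopologicalSpace X] (T : X → X) {𝒰 : Set (Set X)} (h : IsOpenCovering 𝒰) :
    coverEntropyOf T 𝒰 ≤ topEntropy T :=
  le_iSup (fun 𝒰 : {𝒰 : Set (Set X) // IsOpenCovering 𝒰} => coverEntropyOf T 𝒰.1) ⟨𝒰, h⟩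

lemma coverEntropyOf_nonneg (T : X → X) (𝒰 : Set (Set X)) : 0 ≤ coverEntropyOf T 𝒰 := by
  refine le_limsup_of_le (by isBoundedDefault) fun b hb => ?_
  obtain ⟨n, hn⟩ := hb.exists
  refine le_trans ?_ hn
  exact_mod_cast div_nonneg (Real.log_natCast_nonneg _) (Nat.cast_nonneg n)

lemma topEntropy_nonneg [TopologicalSpace X] (T : X → X) : 0 ≤ topEntropy T :=
  (coverEntropyOf_nonneg T {univ}).trans
    (coverEntropyOf_le T ⟨by simp, by simp⟩)

lemma coverEntropyOf_mono_refine [TopologicalSpace X] [CompactSpace X] {T : X → X}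
    (hT : Continuous T) {𝒰 𝒱 : Set (Set X)} (hV : IsOpenCovering 𝒱)
    (h : ∀ V ∈ 𝒱, ∃ U ∈ 𝒰, V ⊆ U) : coverEntropyOf T 𝒰 ≤ coverEntropyOf T 𝒱 := by
  refine coverEntropyOf_mono fun n =>
    coverNumber_le_of_refine (iterJoin_isOpenCover hT hV n).finCov ?_
  rintro W ⟨φ, hφ, rfl⟩
  choose ψ hψ hs using fun i => h _ (hφ i)
  exact ⟨_, ⟨ψ, hψ, rfl⟩, iInter_mono fun i => preimage_mono (hs i)⟩

/-- The topological entropy does not increase under factor maps. -/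
lemma topEntropy_le_of_factor [TopologicalSpace X] [CompactSpace X] [TopologicalSpace Y]
    {T : X → X} {S : Y → Y} (hT : Continuous T) {π : X → Y} (hπ : Continuous π)
    (hs : Function.Surjective π) (h : Function.Semiconj π T S) : topEntropy S ≤ topEntropy T := by
  refine iSup_le fun ⟨𝒱, hV⟩ => ?_
  have hU : IsOpenCovering ((π ⁻¹' ·) '' 𝒱) := by
    refine ⟨?_, eq_univ_of_forall fun x => ?_⟩
    · rintro _ ⟨V, hV', rfl⟩
      exact (hV.1 V hV').preimage hπ
    · obtain ⟨V, hV', hx⟩ := FinCov.exists_mem hV.2 (π x)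
      exact ⟨_, ⟨V, hV', rfl⟩, hx⟩
  refine le_trans (coverEntropyOf_mono fun n => ?_) (coverEntropyOf_le T hU)
  obtain ⟨s, h1, h2, h3⟩ := (iterJoin_isOpenCover hT hU n).finCov.exists_card
  have key : ∀ W ∈ s, ∃ W' ∈ iterJoin S 𝒱 n, W = π ⁻¹' W' := by
    intro W hW
    obtain ⟨φ, hφ, rfl⟩ := h1 hW
    choose ψ hψ hs using hφ
    refine ⟨_, ⟨ψ, hψ, rfl⟩, ?_⟩
    ext x
    simp only [mem_iInter, mem_preimage, ← hs]
    exact forall_congr' fun i => by rw [(h.iterate_right i).eq]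
  choose! f hf hf' using key
  rw [← h3]
  refine coverNumber_le_of_index s f hf fun y => ?_
  obtain ⟨x, rfl⟩ := hs y
  obtain ⟨W, hW, hx⟩ := FinCov.exists_mem h2 x
  refine ⟨W, hW, ?_⟩
  rw [hf' W hW] at hx
  exact hx

/-- The open sets that are small of order `D`. -/
def smallOpens [TopologicalSpace X] (D : Set (X × X)) : Set (Set X) :=
  {V | IsOpen V ∧ V ×ˢ V ⊆ D}

lemma smallOpens_isOpenCover [UniformSpace X] {D : Set (X × X)} (hD : D ∈ 𝓤 X) :
    IsOpenCovering (smallOpens D) := by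
  refine ⟨fun V hV => hV.1, eq_univ_of_forall fun x => ?_⟩
  have : D ∈ 𝓝 (x, x) := nhds_le_uniformity x hD
  rw [nhds_prod_eq] at this
  obtain ⟨V, hV, hVD⟩ := mem_prod_self_iff.1 this
  refine ⟨interior V, ⟨isOpen_interior, (Set.prod_mono interior_subset interior_subset).trans hVD⟩,
    mem_interior_iff_mem_nhds.2 hV⟩

/-- A compact system that is separated by factors of zero entropy has zero entropy. -/
lemma topEntropy_eq_zero_of_separating {ι : Type*} {Y : ι → Type*} [TopologicalSpace X]
    [CompactSpace X] [Nonempty X] [∀ i, TopologicalSpace (Y i)] [∀ i, CompactSpace (Y i)]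
    [∀ i, T2Space (Y i)] {T : X → X} (hT : Continuous T) {S : ∀ i, Y i → Y i}
    (hS : ∀ i, Continuous (S i)) {π : ∀ i, X → Y i} (hπ : ∀ i, Continuous (π i))
    (h : ∀ i, Function.Semiconj (π i) T (S i)) (hsep : ∀ x y, (∀ i, π i x = π i y) → x = y)
    (h0 : ∀ i, topEntropy (S i) = 0) : topEntropy T = 0 := by
  let _ : ∀ i, UniformSpace (Y i) := fun i => uniformSpaceOfCompactR1
  let Φ : X → ∀ i, Y i := fun x i => π i x
  have hΦ : IsClosedEmbedding Φ := Continuous.isClosedEmbedding (continuous_pi hπ)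
    fun x y hxy => hsep x y fun i => congrFun hxy i
  let _ : UniformSpace X := hΦ.isEmbedding.comapUniformSpace
  have hunif : 𝓤 X = comap (fun a => (Φ a.1, Φ a.2)) (𝓤 (∀ i, Y i)) := rfl
  -- the sets `D` whose cover by small open sets has zero entropy
  let G : Filter (X × X) :=
    { sets := {D | IsOpenCovering (smallOpens D) ∧ coverEntropyOf T (smallOpens D) ≤ 0}
      univ_sets := by
        have hu : IsOpenCovering ({univ} : Set (Set X)) := ⟨by simp, by simp⟩
        refine ⟨smallOpens_isOpenCover univ_mem, ?_⟩
        refine (coverEntropyOf_mono_refine hT hu ?_).trans ?_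
        · rintro V -
          exact ⟨univ, ⟨isOpen_univ, subset_univ _⟩, subset_univ _⟩
        · refine limsup_le_of_le (by isBoundedDefault) (Eventually.of_forall fun n => ?_)
          have : coverNumber (iterJoin T ({univ} : Set (Set X)) n) ≤ 1 := by
            refine (coverNumber_le_card (s := {univ}) ?_ (by simp)).trans (by simp)
            simp only [Finset.coe_singleton, singleton_subset_iff]
            exact ⟨fun _ => univ, fun _ => rfl, by simp⟩
          have h2 : Real.log (coverNumber (iterJoin T ({univ} : Set (Set X)) n)) = 0 := by
            interval_cases coverNumber (iterJoin T ({univ} : Set (Set X)) n) <;> simp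
          simp [h2]
      sets_of_superset := by
        rintro D D' ⟨hD, hD0⟩ hDD'
        have hr : ∀ V ∈ smallOpens D, ∃ U ∈ smallOpens D', V ⊆ U :=
          fun V hV => ⟨V, ⟨hV.1, hV.2.trans hDD'⟩, Subset.rfl⟩
        refine ⟨⟨fun V hV => hV.1, eq_univ_of_forall fun x => ?_⟩,
          (coverEntropyOf_mono_refine hT hD hr).trans hD0⟩
        obtain ⟨V, hV, hx⟩ := FinCov.exists_mem hD.2 x
        obtain ⟨U, hU, hVU⟩ := hr V hV
        exact ⟨U, hU, hVU hx⟩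
      inter_sets := by
        rintro D D' ⟨hD, hD0⟩ ⟨hD', hD0'⟩
        have hi : ∀ V ∈ smallOpens D, ∀ V' ∈ smallOpens D', V ∩ V' ∈ smallOpens (D ∩ D') := by
          intro V hV V' hV'
          refine ⟨hV.1.inter hV'.1, fun p hp => ⟨hV.2 ⟨hp.1.1, hp.2.1⟩, hV'.2 ⟨hp.1.2, hp.2.2⟩⟩⟩
        refine ⟨⟨fun V hV => hV.1, eq_univ_of_forall fun x => ?_⟩, ?_⟩
        · obtain ⟨V, hV, hx⟩ := FinCov.exists_mem hD.2 x
          obtain ⟨V', hV', hx'⟩ := FinCov.exists_mem hD'.2 x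
          exact ⟨_, hi V hV V' hV', hx, hx'⟩
        have hle : ∀ n, coverNumber (iterJoin T (smallOpens (D ∩ D')) n) ≤
            coverNumber (iterJoin T (smallOpens D) n) *
              coverNumber (iterJoin T (smallOpens D') n) := by
          intro n
          obtain ⟨s, h1, h2, h3⟩ := (iterJoin_isOpenCover hT hD n).finCov.exists_card
          obtain ⟨s', h1', h2', h3'⟩ := (iterJoin_isOpenCover hT hD' n).finCov.exists_card
          rw [← h3, ← h3', ← Finset.card_product]
          refine coverNumber_le_of_index (s ×ˢ s') (fun p => p.1 ∩ p.2) ?_ fun x => ?_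
          · rintro ⟨W, W'⟩ hp
            obtain ⟨hW, hW'⟩ := Finset.mem_product.1 hp
            obtain ⟨φ, hφ, rfl⟩ := h1 hW
            obtain ⟨φ', hφ', rfl⟩ := h1' hW'
            refine ⟨fun i => φ i ∩ φ' i, fun i => hi _ (hφ i) _ (hφ' i), ?_⟩
            simp only [preimage_inter, iInter_inter_distrib]
          · obtain ⟨V, hV, hx⟩ := FinCov.exists_mem h2 x
            obtain ⟨V', hV', hx'⟩ := FinCov.exists_mem h2' x
            exact ⟨(V, V'), Finset.mem_product.2 ⟨hV, hV'⟩, hx, hx'⟩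
        have hD1 := hD0.antisymm (coverEntropyOf_nonneg _ _)
        have hD1' := hD0'.antisymm (coverEntropyOf_nonneg _ _)
        calc coverEntropyOf T (smallOpens (D ∩ D'))
            ≤ limsup ((fun n : ℕ => ((Real.log (coverNumber
                (iterJoin T (smallOpens D) n)) / n : ℝ) : EReal)) +
              (fun n : ℕ => ((Real.log (coverNumber
                (iterJoin T (smallOpens D') n)) / n : ℝ) : EReal))) atTop := by
              refine limsup_le_limsup (Eventually.of_forall fun n => ?_)
              rw [Pi.add_apply, ← EReal.coe_add, EReal.coe_le_coe_iff, ← add_div]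
              gcongr
              rcases Nat.eq_zero_or_pos (coverNumber (iterJoin T (smallOpens (D ∩ D')) n))
                with h0 | h0
              · rw [h0]
                simpa using add_nonneg (Real.log_natCast_nonneg _) (Real.log_natCast_nonneg _)
              · have hp := h0.trans_le (hle n)
                have ha := Nat.pos_of_mul_pos_right hp
                have hb := Nat.pos_of_mul_pos_left hp
                rw [← Real.log_mul (by positivity) (by positivity)]
                gcongr
                exact_mod_cast hle n
          _ ≤ coverEntropyOf T (smallOpens D) + coverEntropyOf T (smallOpens D') := by
              refine EReal.limsup_add_le (Or.inl ?_) (Or.inl ?_)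
              · change coverEntropyOf T (smallOpens D) ≠ ⊥
                rw [hD1]; exact EReal.zero_ne_bot
              · change coverEntropyOf T (smallOpens D) ≠ ⊤
                rw [hD1]; exact EReal.zero_ne_top
          _ ≤ 0 := by rw [hD1, hD1']; simp }
  have hG : G ≤ 𝓤 X := by
    rw [hunif, Pi.uniformity, comap_iInf]
    refine le_iInf fun i => ?_
    rw [comap_comap]
    rintro D ⟨E, hE, hED⟩
    have hE' := smallOpens_isOpenCover hE
    have hpre : ∀ V ∈ smallOpens E, π i ⁻¹' V ∈ smallOpens D := fun V hV =>
      ⟨hV.1.preimage (hπ i), fun p hp => hED (hV.2 ⟨hp.1, hp.2⟩)⟩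
    refine ⟨⟨fun V hV => hV.1, eq_univ_of_forall fun x => ?_⟩, ?_⟩
    · obtain ⟨V, hV, hx⟩ := FinCov.exists_mem hE'.2 (π i x)
      exact ⟨_, hpre V hV, hx⟩
    refine le_trans ?_ ((coverEntropyOf_le (S i) hE').trans (h0 i).le)
    refine coverEntropyOf_mono fun n => ?_
    obtain ⟨s, h1, h2, h3⟩ := (iterJoin_isOpenCover (hS i) hE' n).finCov.exists_card
    rw [← h3]
    refine coverNumber_le_of_index s (fun W => π i ⁻¹' W) ?_ fun x => ?_
    · intro W hW
      obtain ⟨φ, hφ, rfl⟩ := h1 hW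
      refine ⟨fun j => π i ⁻¹' (φ j), fun j => hpre _ (hφ j), ?_⟩
      ext x
      simp only [mem_iInter, mem_preimage]
      exact forall_congr' fun j => by rw [((h i).iterate_right j).eq]
    · exact FinCov.exists_mem h2 (π i x)
  refine le_antisymm (iSup_le fun ⟨𝒰, hU⟩ => ?_) (topEntropy_nonneg T)
  obtain ⟨D, hD, hDU⟩ := lebesgue_number_lemma_sUnion isCompact_univ hU.1 hU.2.ge
  obtain ⟨-, hD0⟩ := hG hD
  refine le_trans (coverEntropyOf_mono_refine hT (smallOpens_isOpenCover hD) ?_) hD0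
  intro V hV
  rcases V.eq_empty_or_nonempty with rfl | ⟨x, hx⟩
  · obtain ⟨U, hU', -⟩ := FinCov.exists_mem hU.2 (Classical.arbitrary X)
    exact ⟨U, hU', empty_subset _⟩
  · obtain ⟨U, hU', hx'⟩ := hDU x (mem_univ x)
    exact ⟨U, hU', fun y hy => hx' (hV.2 ⟨hx, hy⟩ : (x, y) ∈ D)⟩

end TopologicalEntropy

section Anqies

open WeakDual

lemma charSpace_ext {L : Type*} [CommCStarAlgebra L] (S : Set L) (B : StarSubalgebra ℂ L)
    [IsClosed (B : Set L)] (hB : B = (StarAlgebra.adjoin ℂ S).topologicalClosure)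
    (ρ τ : characterSpace ℂ B) (h : ∀ x ∈ S, ∀ hx : x ∈ B, ρ ⟨x, hx⟩ = τ ⟨x, hx⟩) : ρ = τ := by
  have h1 : ∀ x, x ∈ StarAlgebra.adjoin ℂ S → ∀ hx : x ∈ B, ρ ⟨x, hx⟩ = τ ⟨x, hx⟩ := by
    have hle : StarAlgebra.adjoin ℂ S ≤ B := hB ▸ StarSubalgebra.le_topologicalClosure _
    intro x hx
    induction hx using StarAlgebra.adjoin_induction with
    | mem x hx => exact h x hx
    | algebraMap r =>
      intro _
      exact (AlgHomClass.commutes ρ r).trans (AlgHomClass.commutes τ r).symm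
    | add x y hx hy h1 h2 =>
      intro _
      exact (map_add ρ ⟨x, hle hx⟩ ⟨y, hle hy⟩).trans
        ((congrArg₂ _ (h1 _) (h2 _)).trans (map_add τ ⟨x, hle hx⟩ ⟨y, hle hy⟩).symm)
    | mul x y hx hy h1 h2 =>
      intro _
      exact (map_mul ρ ⟨x, hle hx⟩ ⟨y, hle hy⟩).trans
        ((congrArg₂ _ (h1 _) (h2 _)).trans (map_mul τ ⟨x, hle hx⟩ ⟨y, hle hy⟩).symm)
    | star x hx h1 =>
      intro _
      exact (map_star ρ ⟨x, hle hx⟩).trans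
        ((congrArg star (h1 _)).trans (map_star τ ⟨x, hle hx⟩).symm)
  refine DFunLike.ext ρ τ fun x => ?_
  have hcl : closure {x : B | (x : L) ∈ StarAlgebra.adjoin ℂ S} = Set.univ := by
    refine eq_univ_of_forall fun y => ?_
    have hy : (y : L) ∈ closure (StarAlgebra.adjoin ℂ S : Set L) := by
      have h2 : (B : Set L) = closure (StarAlgebra.adjoin ℂ S : Set L) := congrArg _ hB
      exact h2 ▸ y.2
    rw [closure_subtype]
    refine closure_mono ?_ hy
    intro z hz
    exact ⟨⟨z, hB ▸ StarSubalgebra.le_topologicalClosure _ hz⟩, hz, rfl⟩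
  have hc : IsClosed {x : B | ρ x = τ x} := isClosed_eq (map_continuous ρ) (map_continuous τ)
  have hsub : closure {x : B | (x : L) ∈ StarAlgebra.adjoin ℂ S} ⊆ {x : B | ρ x = τ x} :=
    closure_minimal (fun z hz => h1 z hz z.2) hc
  exact hsub (hcl ▸ mem_univ x)

/-- The C*-algebra `l^∞(ℕ)` of bounded arithmetic functions. -/
def LInf : Type := lp (fun _ : ℕ => ℂ) ∞

noncomputable instance : CommCStarAlgebra LInf :=
  inferInstanceAs (CommCStarAlgebra (lp (fun _ : ℕ => ℂ) ∞))

instance : CoeFun LInf fun _ => ℕ → ℂ := ⟨fun f => (f : lp (fun _ : ℕ => ℂ) ∞).1⟩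

lemma LInf.ext {f g : LInf} (h : ∀ n, f n = g n) : f = g := lp.ext (funext h)

/-- Evaluation at `n` on `l^∞(ℕ)`. -/
noncomputable def evalHom (n : ℕ) : LInf →ₐ[ℂ] ℂ where
  toFun f := f n
  map_one' := rfl
  map_mul' _ _ := rfl
  map_zero' := rfl
  map_add' _ _ := rfl
  commutes' _ := rfl

/-- The map `σ` on `l^∞(ℕ)` given by `(σ f)(n) = f (n + 1)`. -/
noncomputable def shift : LInf →⋆ₐ[ℂ] LInf where
  toFun f := (⟨fun n => f (n + 1), memℓp_infty <| by
    obtain ⟨C, hC⟩ := memℓp_infty_iff.1 f.2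
    exact ⟨C, by rintro _ ⟨n, rfl⟩; exact hC ⟨n + 1, rfl⟩⟩⟩ : lp (fun _ : ℕ => ℂ) ∞)
  map_one' := rfl
  map_mul' _ _ := rfl
  map_zero' := rfl
  map_add' _ _ := rfl
  commutes' _ := rfl
  map_star' _ := rfl

@[simp] lemma shift_apply (f : LInf) (n : ℕ) : shift f n = f (n + 1) := rfl

/-- An anqie: a norm closed unital star subalgebra of `l^∞(ℕ)` that is invariant under `σ`. -/
structure Anqie where
  alg : StarSubalgebra ℂ LInf
  isClosed : IsClosed (alg : Set LInf)
  shift_mem : ∀ f ∈ alg, shift f ∈ alg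

namespace Anqie

instance (A : Anqie) : IsClosed (A.alg : Set LInf) := A.isClosed

/-- The maximal ideal space of an anqie: its multiplicative states with the weak* topology. -/
abbrev Spec (A : Anqie) : Type := characterSpace ℂ A.alg

/-- The restriction of `σ` to an anqie. -/
noncomputable def shiftHom (A : Anqie) : A.alg →⋆ₐ[ℂ] A.alg :=
  (shift.comp A.alg.subtype).codRestrict A.alg fun f => A.shift_mem f f.2

@[simp] lemma coe_shiftHom (A : Anqie) (f : A.alg) : (A.shiftHom f : LInf) = shift f := rfl

/-- The additive map of an anqie: `(A ρ)(f) = ρ (σ f)`. -/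
noncomputable def additiveMap (A : Anqie) : C(A.Spec, A.Spec) :=
  CharacterSpace.compContinuousMap A.shiftHom

@[simp] lemma additiveMap_apply (A : Anqie) (ρ : A.Spec) (f : A.alg) :
    A.additiveMap ρ f = ρ (A.shiftHom f) := rfl

/-- The canonical map `ι : ℕ → X` to the maximal ideal space, `ι n` being the evaluation at `n`. -/
noncomputable def point (A : Anqie) (n : ℕ) : A.Spec :=
  CharacterSpace.equivAlgHom.symm ((evalHom n).comp A.alg.subtype.toAlgHom)

@[simp] lemma point_apply (A : Anqie) (n : ℕ) (f : A.alg) : A.point n f = (f : LInf) n := rfl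

/-- The additive map extends `ι n ↦ ι (n + 1)`. -/
lemma additiveMap_point (A : Anqie) (n : ℕ) : A.additiveMap (A.point n) = A.point (n + 1) :=
  rfl

/-- The points `ι n` are dense, so the additive map is the only continuous map that extends
`ι n ↦ ι (n + 1)`. -/
lemma denseRange_point (A : Anqie) : DenseRange A.point := by
  by_contra hd
  obtain ⟨ρ, hρ⟩ := not_forall.1 hd
  obtain ⟨G, h0, h1, -⟩ := exists_continuous_zero_one_of_isClosed
    (isClosed_closure (s := range A.point)) (isClosed_singleton (x := ρ))
    (disjoint_singleton_right.2 hρ)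
  obtain ⟨g, hg⟩ := (gelfandTransform_bijective A.alg).2
    ((⟨Complex.ofReal, Complex.continuous_ofReal⟩ : C(ℝ, ℂ)).comp G)
  have hg' : ∀ τ : A.Spec, τ g = (G τ : ℂ) := fun τ => DFunLike.congr_fun hg τ
  have : g = 0 := by
    apply Subtype.ext
    refine LInf.ext fun n => ?_
    have := hg' (A.point n)
    rw [h0 (subset_closure ⟨n, rfl⟩)] at this
    exact this.trans (by simp; rfl)
  have h2 := hg' ρ
  rw [h1 rfl, this] at h2
  simp at h2

instance (A : Anqie) : Nonempty A.Spec := ⟨A.point 0⟩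

/-- The anqie entropy of an anqie is the topological entropy of its additive map. -/
noncomputable def entropy (A : Anqie) : EReal := topEntropy A.additiveMap

/-- The restriction of multiplicative states to a subanqie. -/
noncomputable def restrict {A B : Anqie} (h : A.alg ≤ B.alg) : C(B.Spec, A.Spec) :=
  CharacterSpace.compContinuousMap (StarSubalgebra.inclusion h)

lemma restrict_apply {A B : Anqie} (h : A.alg ≤ B.alg) (ρ : B.Spec) (f : A.alg) :
    restrict h ρ f = ρ ⟨f, h f.2⟩ := rfl

lemma restrict_semiconj {A B : Anqie} (h : A.alg ≤ B.alg) :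
    Function.Semiconj (restrict h) B.additiveMap A.additiveMap := fun _ => rfl

lemma restrict_surjective {A B : Anqie} (h : A.alg ≤ B.alg) :
    Function.Surjective (restrict h) := by
  rw [← range_eq_univ, ← (isCompact_range (restrict h).continuous).isClosed.closure_eq]
  refine (A.denseRange_point.mono ?_).closure_eq
  rintro _ ⟨n, rfl⟩
  exact ⟨B.point n, rfl⟩

lemma entropy_mono {A B : Anqie} (h : A.alg ≤ B.alg) : A.entropy ≤ B.entropy :=
  topEntropy_le_of_factor B.additiveMap.continuous (restrict h).continuous
    (restrict_surjective h) (restrict_semiconj h)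

lemma iterate_shift_mem (A : Anqie) {f : LInf} (hf : f ∈ A.alg) (j : ℕ) :
    shift^[j] f ∈ A.alg := by
  induction j with
  | zero => exact hf
  | succ j ih => rw [Function.iterate_succ_apply']; exact A.shift_mem _ ih

/-- The anqie generated by a family `F` of bounded arithmetic functions: the C*-algebra generated
by `1` and all `σ^j f`, `f ∈ F`. -/
noncomputable def generated (F : Set LInf) : Anqie where
  alg := (StarAlgebra.adjoin ℂ {g | ∃ f ∈ F, ∃ j : ℕ, g = shift^[j] f}).topologicalClosure
  isClosed := StarSubalgebra.isClosed_topologicalClosure _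
  shift_mem := by
    set S : Set LInf := {g | ∃ f ∈ F, ∃ j : ℕ, g = shift^[j] f}
    have hc : Continuous shift :=
      AddMonoidHomClass.continuous_of_bound shift 1 fun f => by
        simpa using NonUnitalStarAlgHom.norm_apply_le shift f
    have h1 : StarAlgebra.adjoin ℂ S ≤ (StarAlgebra.adjoin ℂ S).comap shift := by
      refine StarAlgebra.adjoin_le ?_
      rintro _ ⟨f, hf, j, rfl⟩
      refine StarAlgebra.subset_adjoin ℂ S ⟨f, hf, j + 1, ?_⟩
      exact (Function.iterate_succ_apply' shift j f).symm
    intro f hf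
    exact map_mem_closure hc hf fun g hg => h1 hg

lemma subset_generated (F : Set LInf) : F ⊆ (generated F).alg := fun f hf =>
  StarSubalgebra.le_topologicalClosure _ (StarAlgebra.subset_adjoin ℂ _ ⟨f, hf, 0, rfl⟩)

/-- `generated F` is the smallest anqie that contains `F`. -/
lemma generated_le {F : Set LInf} {A : Anqie} (h : F ⊆ A.alg) : (generated F).alg ≤ A.alg := by
  refine StarSubalgebra.topologicalClosure_minimal (StarAlgebra.adjoin_le ?_) A.isClosed
  rintro _ ⟨f, hf, j, rfl⟩
  exact iterate_shift_mem A (h hf) j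

/-- The anqie entropy of a family of bounded arithmetic functions. -/
noncomputable def entropyOf (F : Set LInf) : EReal := (generated F).entropy

lemma entropy_eq_zero_of_separating {A : Anqie} {ι : Type*} {B : ι → Anqie}
    (hle : ∀ i, (B i).alg ≤ A.alg) (h0 : ∀ i, (B i).entropy = 0)
    (hsep : ∀ ρ τ : A.Spec, (∀ i, restrict (hle i) ρ = restrict (hle i) τ) → ρ = τ) :
    A.entropy = 0 :=
  topEntropy_eq_zero_of_separating A.additiveMap.continuous
    (fun i => (B i).additiveMap.continuous) (fun i => (restrict (hle i)).continuous)
    (fun i => restrict_semiconj (hle i)) hsep h0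

lemma restrict_apply_eq {A B : Anqie} (h : A.alg ≤ B.alg) {ρ τ : B.Spec}
    (hρτ : restrict h ρ = restrict h τ) {f : LInf} (hf : f ∈ A.alg) (hf' : f ∈ B.alg) :
    ρ ⟨f, hf'⟩ = τ ⟨f, hf'⟩ :=
  congrArg (fun θ : A.Spec => θ ⟨f, hf⟩) hρτ

lemma spec_generated_ext {F : Set LInf} {ρ τ : (generated F).Spec}
    (h : ∀ f ∈ F, ∀ j : ℕ, ∀ hf : shift^[j] f ∈ (generated F).alg, ρ ⟨_, hf⟩ = τ ⟨_, hf⟩) :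
    ρ = τ := by
  refine charSpace_ext {g | ∃ f ∈ F, ∃ j : ℕ, g = shift^[j] f} (generated F).alg rfl ρ τ ?_
  rintro x ⟨f, hf, j, rfl⟩ hx
  exact h f hf j hx

lemma entropyOf_eq_zero_of_mem {F : Set LInf} (hF : ∀ f ∈ F, entropyOf {f} = 0) :
    entropyOf F = 0 := by
  have hle : ∀ f : F, (generated {(f : LInf)}).alg ≤ (generated F).alg := fun f =>
    generated_le (singleton_subset_iff.2 (subset_generated F f.2))
  refine entropy_eq_zero_of_separating hle (fun f => hF f f.2) fun ρ τ hρτ => ?_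
  refine spec_generated_ext fun f hf j hfj => ?_
  exact restrict_apply_eq (hle ⟨f, hf⟩) (hρτ ⟨f, hf⟩)
    (iterate_shift_mem _ (subset_generated {f} rfl) j) hfj

end Anqie

/-- The set of bounded arithmetic functions with zero anqie entropy is the anqie that it
generates. -/
lemma generated_zeroEntropy_eq :
    ((Anqie.generated {f | Anqie.entropyOf {f} = 0}).alg : Set LInf) =
      {f | Anqie.entropyOf {f} = 0} := by
  refine Subset.antisymm (fun f hf => ?_) (Anqie.subset_generated _)
  refine le_antisymm ?_ (topEntropy_nonneg _)
  refine (Anqie.entropy_mono (Anqie.generated_le (singleton_subset_iff.2 hf))).trans ?_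
  exact (Anqie.entropyOf_eq_zero_of_mem fun f hf => hf).le

/-- The anqie `ℰ₀(ℕ)` of all bounded arithmetic functions with zero anqie entropy. -/
noncomputable def zeroEntropyAnqie : Anqie where
  alg := (Anqie.generated {f | Anqie.entropyOf {f} = 0}).alg.copy
    {f | Anqie.entropyOf {f} = 0} generated_zeroEntropy_eq.symm
  isClosed := by
    rw [StarSubalgebra.copy_eq]
    exact (Anqie.generated {f | Anqie.entropyOf {f} = 0}).isClosed
  shift_mem := by
    rw [StarSubalgebra.copy_eq]
    exact (Anqie.generated {f | Anqie.entropyOf {f} = 0}).shift_mem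

lemma mem_zeroEntropyAnqie {f : LInf} :
    f ∈ zeroEntropyAnqie.alg ↔ Anqie.entropyOf {f} = 0 := Iff.rfl

/-- The C*-algebra `ℰ₀(ℕ)`. Its underlying set is `{f | entropyOf {f} = 0}`. -/
noncomputable abbrev E0 : StarSubalgebra ℂ LInf := zeroEntropyAnqie.alg

end Anqies

section KTheory

variable {A : Type*} [CStarAlgebra A]

variable (A) in
/-- `𝒰_k(A)`: the unitary group of the C*-algebra `M_k(A)`, with the norm topology. -/
abbrev UMat (k : ℕ) : Type _ := unitary (CStarMatrix (Fin k) (Fin k) A)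

/-- `u ∼ₕ v`: there is a continuous path in `𝒰_k(A)` from `u` to `v`. -/
def UHomotopic {k : ℕ} (u v : UMat A k) : Prop :=
  ∃ γ : unitInterval → UMat A k, Continuous γ ∧ γ 0 = u ∧ γ 1 = v

lemma uHomotopic_iff_joined {k : ℕ} {u v : UMat A k} : UHomotopic u v ↔ Joined u v :=
  ⟨fun ⟨γ, hc, h0, h1⟩ => ⟨⟨⟨γ, hc⟩, h0, h1⟩⟩, fun ⟨γ⟩ => ⟨γ, γ.continuous, γ.source, γ.target⟩⟩

/-- The `k × k` matrix `diag(M, 1_{k-n})`, for an `n × n` matrix `M` and `n ≤ k`. -/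
def padMatrix {n : ℕ} (k : ℕ) (M : CStarMatrix (Fin n) (Fin n) A) :
    CStarMatrix (Fin k) (Fin k) A := fun i j =>
  if h : (i : ℕ) < n ∧ (j : ℕ) < n then M ⟨i, h.1⟩ ⟨j, h.2⟩ else if i = j then 1 else 0

section

variable {n d : ℕ} (M : CStarMatrix (Fin n) (Fin n) A)

lemma padMatrix_apply₁₁ (i j : Fin n) :
    padMatrix (n + d) M (Fin.castAdd d i) (Fin.castAdd d j) = M i j := by simp [padMatrix]

lemma padMatrix_apply₁₂ (i : Fin n) (j : Fin d) :
    padMatrix (n + d) M (Fin.castAdd d i) (Fin.natAdd n j) = 0 := by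
  have : (i : ℕ) ≠ n + j := by have := i.2; omega
  simp [padMatrix, Fin.ext_iff, this]

lemma padMatrix_apply₂₁ (i : Fin d) (j : Fin n) :
    padMatrix (n + d) M (Fin.natAdd n i) (Fin.castAdd d j) = 0 := by
  have : n + (i : ℕ) ≠ j := by have := j.2; omega
  simp [padMatrix, Fin.ext_iff, this]

lemma padMatrix_apply₂₂ (i j : Fin d) :
    padMatrix (n + d) M (Fin.natAdd n i) (Fin.natAdd n j) = if i = j then 1 else 0 := by
  simp [padMatrix]

end

lemma padMatrix_mul {n k : ℕ} (h : n ≤ k) (M N : CStarMatrix (Fin n) (Fin n) A) :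
    padMatrix k M * padMatrix k N = padMatrix k (M * N) := by
  obtain ⟨d, rfl⟩ := Nat.exists_eq_add_of_le h
  ext i j
  rw [CStarMatrix.mul_apply, Fin.sum_univ_add]
  induction i using Fin.addCases <;> induction j using Fin.addCases <;>
    simp [padMatrix_apply₁₁, padMatrix_apply₁₂, padMatrix_apply₂₁, padMatrix_apply₂₂,
      CStarMatrix.mul_apply]

lemma padMatrix_one {n k : ℕ} : padMatrix k (1 : CStarMatrix (Fin n) (Fin n) A) = 1 := by
  ext i j
  by_cases hij : i = j
  · subst hij
    simp [padMatrix]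
  · have : (i : ℕ) ≠ j := fun hh => hij (Fin.ext hh)
    simp [padMatrix, hij, this]

lemma padMatrix_star {n k : ℕ} (M : CStarMatrix (Fin n) (Fin n) A) :
    star (padMatrix k M) = padMatrix k (star M) := by
  ext i j
  by_cases h : (i : ℕ) < n ∧ (j : ℕ) < n
  · simp [padMatrix, CStarMatrix.star_apply, h]
  · have h' : ¬ ((j : ℕ) < n ∧ (i : ℕ) < n) := fun hh => h hh.symm
    simp only [padMatrix, CStarMatrix.star_apply, h, h', dite_false]
    by_cases hij : i = j
    · simp [hij]
    · simp [hij, Ne.symm hij]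

lemma padMatrix_padMatrix {n k l : ℕ} (h : n ≤ k) (M : CStarMatrix (Fin n) (Fin n) A) :
    padMatrix l (padMatrix k M) = padMatrix l M := by
  ext i j
  simp only [padMatrix]
  by_cases hi : (i : ℕ) < n <;> by_cases hj : (j : ℕ) < n <;>
    by_cases hi' : (i : ℕ) < k <;> by_cases hj' : (j : ℕ) < k <;>
    first
    | omega
    | simp [hi, hj, hi', hj', Fin.ext_iff]

lemma continuous_padMatrix {n k : ℕ} :
    Continuous (padMatrix k : CStarMatrix (Fin n) (Fin n) A → _) := by
  refine continuous_pi fun i => continuous_pi fun j => ?_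
  unfold padMatrix
  split_ifs
  · exact (continuous_apply _).comp (continuous_apply _)
  · exact continuous_const
  · exact continuous_const

/-- The unitary `diag(u, 1_{k-n})`. -/
def padUnitary {n k : ℕ} (h : n ≤ k) (u : UMat A n) : UMat A k :=
  ⟨padMatrix k u.1, Unitary.mem_iff.2
    ⟨by rw [padMatrix_star, padMatrix_mul h, Unitary.star_mul_self_of_mem u.2, padMatrix_one],
     by rw [padMatrix_star, padMatrix_mul h, Unitary.mul_star_self_of_mem u.2, padMatrix_one]⟩⟩

lemma padUnitary_padUnitary {n k l : ℕ} (h : n ≤ k) (h' : k ≤ l) (u : UMat A n) :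
    padUnitary h' (padUnitary h u) = padUnitary (h.trans h') u :=
  Subtype.ext (padMatrix_padMatrix h u.1)

lemma continuous_padUnitary {n k : ℕ} (h : n ≤ k) :
    Continuous (padUnitary h : UMat A n → UMat A k) :=
  (continuous_padMatrix.comp continuous_subtype_val).subtype_mk _

lemma UHomotopic.pad {n k : ℕ} (h : n ≤ k) {u v : UMat A n} (huv : UHomotopic u v) :
    UHomotopic (padUnitary h u) (padUnitary h v) := by
  obtain ⟨γ, hc, rfl, rfl⟩ := huv
  exact ⟨fun t => padUnitary h (γ t), (continuous_padUnitary h).comp hc, rfl, rfl⟩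

variable (A) in
/-- `𝒰_∞(A)`: the disjoint union of the groups `𝒰_k(A)`, `k ≥ 1`. -/
abbrev UInf : Type _ := Σ k : ℕ+, UMat A k

/-- `u ∼₁ v`: `diag(u, 1_{k-n}) ∼ₕ diag(v, 1_{k-m})` for some `k ≥ max {n, m}`. -/
def StablyHomotopic (u v : UInf A) : Prop :=
  ∃ (k : ℕ) (hn : (u.1 : ℕ) ≤ k) (hm : (v.1 : ℕ) ≤ k),
    UHomotopic (padUnitary hn u.2) (padUnitary hm v.2)

variable (A) in
/-- Stable homotopy of unitaries is an equivalence relation. -/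
def stableSetoid : Setoid (UInf A) where
  r := StablyHomotopic
  iseqv :=
    { refl := fun u => ⟨u.1, le_rfl, le_rfl, uHomotopic_iff_joined.2 (Joined.refl _)⟩
      symm := fun ⟨k, hn, hm, h⟩ =>
        ⟨k, hm, hn, uHomotopic_iff_joined.2 (uHomotopic_iff_joined.1 h).symm⟩
      trans := by
        rintro u v w ⟨k, hn, hm, h⟩ ⟨l, hm', hp, h'⟩
        refine ⟨max k l, hn.trans (le_max_left _ _), hp.trans (le_max_right _ _), ?_⟩
        have h1 := h.pad (le_max_left k l)
        have h2 := h'.pad (le_max_right k l)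
        rw [padUnitary_padUnitary, padUnitary_padUnitary] at h1 h2
        exact uHomotopic_iff_joined.2
          ((uHomotopic_iff_joined.1 h1).trans (uHomotopic_iff_joined.1 h2)) }

variable (A) in
/-- The `K₁`-group of a unital C*-algebra: `𝒰_∞(A)` modulo stable homotopy. -/
def K1 : Type _ := Quotient (stableSetoid A)

instance : Inhabited (K1 A) := ⟨Quotient.mk (stableSetoid A) ⟨1, 1⟩⟩

end KTheory

/-! Up to a small perturbation, a unitary over `E0` takes only finitely many values, and a
finite-valued unitary has finite spectrum. Let `u` be a unitary matrix over `E0`. Its entries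
jointly generate an anqie of zero entropy. The central point (`exists_finite_range_approx`) is that
there is an index sequence `q : ℕ → ℕ` of finite range and subexponential complexity such that every
entry `f` satisfies `|f m - f (q m)| ≤ ε` for all `m`. The matrix `V` with value `u (q m)` at `m`
then has entries in `E0` (`entropyOf_comp_eq_zero`), is unitary because each of its values is a
value of `u`, and is homotopic to `u` when `ε` is small. It is annihilated by the product of the
characteristic polynomials of its finitely many values, so its spectrum misses a point of the circle
and `V` is connected to `1`.

To build `q`, zero entropy is used at scales `n 0 ∣ n 1 ∣ ⋯`: at scale `n j` the aligned blocks have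
at most `exp (n j / (j + 1))` representatives up to an error `e j`, with `∑ e j ≤ ε`
(`exists_block_representatives`). Replacing blocks by representatives at one scale does not control
the complexity at larger ones, so the replacements at all scales are composed, the coarsest first. A
coarse replacement moves finer aligned blocks as wholes, so the few representatives at every scale
survive in the composition (`exists_blockComp_block`). Block `0` always represents itself, so only
finitely many maps act at each index and the infinite composition makes sense
(`blockComp_eq_of_lt`). -/

/-! ### Entropy bounds from counting itineraries -/

/-- The set of words of length `L` of the itineraries `j ↦ φ (T^j x)`. -/
def itineraryWords {X F : Type*} (T : X → X) (φ : X → F) (L : ℕ) : Set (Fin L → F) :=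
  range fun (x : X) (i : Fin L) => φ (T^[i] x)

section Words

variable {X F : Type*} [TopologicalSpace X] [CompactSpace X] [TopologicalSpace F]
  [DiscreteTopology F]

/-- The cylinders of a generating finite colouring are eventually finer than a given open cover. -/
lemma exists_cylinder_subset {T : X → X} (hT : Continuous T) {φ : X → F} (hφ : Continuous φ)
    (hsep : ∀ x y, (∀ j, φ (T^[j] x) = φ (T^[j] y)) → x = y) {𝒰 : Set (Set X)}
    (hU : IsOpenCovering 𝒰) :
    ∃ L : ℕ, ∀ x, ∃ U ∈ 𝒰, ∀ y, (∀ j < L, φ (T^[j] y) = φ (T^[j] x)) → y ∈ U := by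
  let Z : ℕ → X → Set X := fun L x => {y | ∀ j < L, φ (T^[j] y) = φ (T^[j] x)}
  have hZ : ∀ L x, IsClopen (Z L x) := fun L x => by
    have : Z L x = ⋂ j : Fin L, (fun y => φ (T^[j] y)) ⁻¹' {φ (T^[j] x)} := by
      ext y
      simp [Z, Fin.forall_iff]
    rw [this]
    exact isClopen_iInter_of_finite fun j =>
      (isClopen_discrete _).preimage (hφ.comp (hT.iterate j))
  have hmono : ∀ x {L L'}, L ≤ L' → Z L' x ⊆ Z L x := fun x L L' h y hy j hj =>
    hy j (hj.trans_le h)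
  have hloc : ∀ x, ∃ L, ∃ U ∈ 𝒰, Z L x ⊆ U := fun x => by
    obtain ⟨U, hU', hx⟩ := FinCov.exists_mem hU.2 x
    -- The cylinders around `x` decrease to `{x}` by `hsep`, so by compactness one of them already
    -- lies in `U`.
    have hempty : (Uᶜ ∩ ⋂ L, Z L x) = ∅ := by
      refine eq_empty_of_forall_notMem fun y ⟨hy, hy'⟩ => hy ?_
      rw [hsep y x fun j => mem_iInter.1 hy' (j + 1) j (Nat.lt_succ_self j)]
      exact hx
    obtain ⟨L, hL⟩ := IsCompact.elim_directed_family_closed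
      (hU.1 U hU').isClosed_compl.isCompact (fun L => Z L x) (fun L => (hZ L x).1) hempty
      (fun a b => ⟨max a b, hmono x (le_max_left a b), hmono x (le_max_right a b)⟩)
    refine ⟨L, U, hU', fun y hy => by_contra fun hyU => ?_⟩
    exact (hL ▸ (⟨hyU, hy⟩ : y ∈ Uᶜ ∩ Z L x) : y ∈ (∅ : Set X))
  choose L U hU' hL using hloc
  obtain ⟨t, ht⟩ := isCompact_univ.elim_finite_subcover (fun x => Z (L x) x)
    (fun x => (hZ _ x).2) fun x _ => mem_iUnion.2 ⟨x, fun _ _ => rfl⟩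
  refine ⟨t.sup L, fun x => ?_⟩
  obtain ⟨z, hz, hxz⟩ := mem_iUnion₂.1 (ht (mem_univ x))
  refine ⟨U z, hU' z, fun y hy => hL z fun j hj => ?_⟩
  exact (hy j (hj.trans_le (Finset.le_sup hz))).trans (hxz j hj)

/-- A system with a generating finite colouring whose itineraries have subexponentially many words
has zero entropy. -/
lemma topEntropy_eq_zero_of_words [Nonempty X] [Finite F] {T : X → X} (hT : Continuous T) {φ : X → F} (hφ : Continuous φ)
    (hsep : ∀ x y, (∀ j, φ (T^[j] x) = φ (T^[j] y)) → x = y)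
    (hw : ∀ δ : ℝ, 0 < δ → ∀ᶠ L in atTop, Real.log (itineraryWords T φ L).ncard ≤ δ * L) :
    topEntropy T = 0 := by
  classical
  refine le_antisymm (iSup_le fun ⟨𝒰, hU⟩ => ?_) (topEntropy_nonneg T)
  obtain ⟨L, hL⟩ := exists_cylinder_subset hT hφ hsep hU
  choose U hU' hUy using hL
  -- A word of length `n + L` determines `L` consecutive symbols from each time `i < n` on, hence a
  -- member of `𝒰` containing the orbit point at that time.
  have hcard : ∀ n, coverNumber (iterJoin T 𝒰 n) ≤ (itineraryWords T φ (n + L)).ncard := by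
    intro n
    have hfin : (itineraryWords T φ (n + L)).Finite := toFinite _
    choose! x hx using fun (w : Fin (n + L) → F) (hw : w ∈ itineraryWords T φ (n + L)) => hw
    rw [ncard_eq_toFinset_card _ hfin]
    refine coverNumber_le_of_index _ (fun w => ⋂ i : Fin n, T^[(i : ℕ)] ⁻¹' (U (T^[i] (x w))))
      (fun w _ => ⟨_, fun i => hU' _, rfl⟩) fun y => ?_
    have hmem : (fun i : Fin (n + L) => φ (T^[i] y)) ∈ itineraryWords T φ (n + L) := ⟨y, rfl⟩
    refine ⟨_, hfin.mem_toFinset.2 hmem, mem_iInter.2 fun i => hUy _ _ fun j hj => ?_⟩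
    have := congrFun (hx _ hmem) ⟨j + i, by omega⟩
    simp only [Function.iterate_add_apply] at this
    exact this.symm
  refine EReal.le_of_forall_lt_iff_le.1 fun δ hδ => ?_
  have hδ0 : 0 < δ := by exact_mod_cast hδ
  refine limsup_le_of_le (by isBoundedDefault) ?_
  -- Half of `δ` pays for the `L` extra letters: `δ / 2 * (n + L) ≤ δ * n` once `n ≥ L`.
  have hw' := (tendsto_add_atTop_nat L).eventually (hw (δ / 2) (by positivity))
  filter_upwards [hw', eventually_ge_atTop (max 1 L)] with n hn hnL
  rw [EReal.coe_le_coe_iff]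
  have hn0 : (1 : ℝ) ≤ n := by exact_mod_cast (le_max_left 1 L).trans hnL
  have hnL' : (L : ℝ) ≤ n := by exact_mod_cast (le_max_right 1 L).trans hnL
  rw [div_le_iff₀ (by linarith)]
  have hlog : Real.log (coverNumber (iterJoin T 𝒰 n)) ≤
      Real.log (itineraryWords T φ (n + L)).ncard := by
    rcases Nat.eq_zero_or_pos (coverNumber (iterJoin T 𝒰 n)) with h0 | h0
    · rw [h0]
      simpa using Real.log_natCast_nonneg _
    · exact Real.log_le_log (by exact_mod_cast h0) (by exact_mod_cast hcard n)
  push_cast at hn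
  nlinarith

end Words

/-! ### Sequences of subexponential complexity -/

/-- The words of length `L` of a sequence. -/
def seqWords {F : Type*} (q : ℕ → F) (L : ℕ) : Set (Fin L → F) :=
  range fun (m : ℕ) (i : Fin L) => q (m + i)

/-- A sequence has subexponential complexity if the number of its words of length `L` is
`exp (o(L))`. -/
def SubexpComplexity {F : Type*} (q : ℕ → F) : Prop :=
  ∀ δ : ℝ, 0 < δ → ∀ᶠ L in atTop, Real.log (seqWords q L).ncard ≤ δ * L

lemma seqWords_finite {F : Type*} {q : ℕ → F} (hq : (range q).Finite) (L : ℕ) :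
    (seqWords q L).Finite := by
  refine (Set.Finite.pi' fun _ : Fin L => hq).subset ?_
  rintro _ ⟨m, rfl⟩ i
  exact ⟨_, rfl⟩

lemma Anqie.iterate_additiveMap_apply (A : Anqie) (ρ : A.Spec) {f : LInf} (hf : f ∈ A.alg)
    (j : ℕ) : (A.additiveMap^[j] ρ) ⟨f, hf⟩ = ρ ⟨shift^[j] f, A.iterate_shift_mem hf j⟩ := by
  induction j generalizing ρ with
  | zero => rfl
  | succ j ih =>
    rw [Function.iterate_succ_apply, ih]
    change ρ ⟨shift (shift^[j] f), _⟩ = _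
    congr 2
    exact (Function.iterate_succ_apply' _ _ _).symm

lemma iterate_shift_apply (f : LInf) (j n : ℕ) : (shift^[j] f) n = f (n + j) := by
  induction j generalizing n with
  | zero => rfl
  | succ j ih => rw [Function.iterate_succ_apply', shift_apply, ih, Nat.add_right_comm,
    Nat.add_assoc]

/-- A function of a finite-valued sequence of subexponential complexity has zero anqie entropy. -/
lemma entropyOf_comp_eq_zero {F : Type*} {q : ℕ → F} (hq : (range q).Finite)
    (hw : SubexpComplexity q) (h : F → ℂ) (f : LInf) (hf : ∀ n, f n = h (q n)) :
    Anqie.entropyOf {f} = 0 := by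
  set A := Anqie.generated {f}
  have hfA : f ∈ A.alg := Anqie.subset_generated {f} rfl
  let R : Set ℂ := range fun n => f n
  have hR : R.Finite := by
    refine (hq.image h).subset ?_
    rintro _ ⟨n, rfl⟩
    exact ⟨q n, ⟨n, rfl⟩, (hf n).symm⟩
  have : Finite R := hR
  have hcont : Continuous fun ρ : A.Spec => ρ ⟨f, hfA⟩ :=
    (WeakDual.eval_continuous _).comp continuous_subtype_val
  -- A finite set is closed, so density of the points `ι n` forces every state to take a value of
  -- `f` at `f`. This makes `φ` a finite colouring, and it generates because a state is determined
  -- by its values on the shifts of `f`.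
  have hmem : ∀ ρ : A.Spec, ρ ⟨f, hfA⟩ ∈ R := fun ρ =>
    A.denseRange_point.induction_on ρ (hR.isClosed.preimage hcont) fun n => ⟨n, rfl⟩
  let φ : A.Spec → R := fun ρ => ⟨ρ ⟨f, hfA⟩, hmem ρ⟩
  have hφ : Continuous φ := hcont.subtype_mk _
  have hT := A.additiveMap.continuous
  refine topEntropy_eq_zero_of_words hT hφ (fun ρ τ hρτ => ?_) fun δ hδ => ?_
  · refine Anqie.spec_generated_ext fun g hg j hgj => ?_
    obtain rfl := mem_singleton_iff.1 hg
    have := congrArg Subtype.val (hρτ j)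
    simp only [φ] at this
    rwa [A.iterate_additiveMap_apply, A.iterate_additiveMap_apply] at this
  · filter_upwards [hw δ hδ] with L hL
    -- The itinerary of length `L` is a continuous map to a discrete space, so by density every word
    -- already occurs at some `ι m`.
    have hword : ∀ ρ : A.Spec, (fun i : Fin L => φ (A.additiveMap^[i] ρ)) ∈
        range fun m (i : Fin L) => φ (A.additiveMap^[i] (A.point m)) := fun ρ =>
      A.denseRange_point.induction_on ρ ((isClosed_discrete _).preimage
        (continuous_pi fun i : Fin L => hφ.comp (hT.iterate i))) fun n => ⟨n, rfl⟩
    have hsub : (fun w i => ((w i : R) : ℂ)) '' itineraryWords A.additiveMap φ L ⊆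
        (fun w i => h (w i)) '' seqWords q L := by
      rintro _ ⟨_, ⟨ρ, rfl⟩, rfl⟩
      obtain ⟨m, hm⟩ := hword ρ
      refine ⟨_, ⟨m, rfl⟩, funext fun i => ?_⟩
      have := congrArg Subtype.val (congrFun hm i)
      refine Eq.trans ?_ this
      simp only [φ]
      rw [A.iterate_additiveMap_apply, Anqie.point_apply, ← hf]
      exact (iterate_shift_apply f i m).symm
    have hinj : Function.Injective fun (w : Fin L → R) i => ((w i : R) : ℂ) := fun w w' hww =>
      funext fun i => Subtype.ext (congrFun hww i)
    have hfin := seqWords_finite hq L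
    have hle : (itineraryWords A.additiveMap φ L).ncard ≤ (seqWords q L).ncard := by
      rw [← ncard_image_of_injective _ hinj]
      exact (ncard_le_ncard hsub (hfin.image _)).trans (ncard_image_le hfin)
    have hpos : 0 < (itineraryWords A.additiveMap φ L).ncard :=
      (ncard_pos (toFinite _)).2 ⟨_, A.point 0, rfl⟩
    exact (Real.log_le_log (by exact_mod_cast hpos) (by exact_mod_cast hle)).trans hL

/-! ### Representatives of long blocks -/

/-- In an anqie of zero entropy, for large `n` the blocks `[k n, k n + n)` of a finite family of
members have few representatives up to a small error. -/
lemma exists_block_representatives {A : Anqie} (hA : A.entropy = 0) {ι : Type*} [Fintype ι]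
    (f : ι → LInf) (hf : ∀ a, f a ∈ A.alg) {ε δ : ℝ} (hε : 0 < ε) (hδ : 0 < δ) :
    ∀ᶠ n : ℕ in atTop, ∃ r : ℕ → ℕ, r 0 = 0 ∧ (range r).Finite ∧
      Real.log (range r).ncard ≤ δ * n ∧
      ∀ k, ∀ i < n, dist (fun a => f a (k * n + i)) (fun a => f a (r k * n + i)) ≤ ε := by
  classical
  -- Radius `ε / 2`, so that two points of one member differ by less than `ε` at each `f a`.
  let U : A.Spec → Set A.Spec := fun ρ => {τ | ∀ a, dist (τ ⟨f a, hf a⟩) (ρ ⟨f a, hf a⟩) < ε / 2}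
  have hcont : ∀ a, Continuous fun ρ : A.Spec => ρ ⟨f a, hf a⟩ := fun a =>
    (WeakDual.eval_continuous _).comp continuous_subtype_val
  have hU : IsOpenCovering (range U) := by
    refine ⟨?_, eq_univ_of_forall fun ρ => ⟨U ρ, ⟨ρ, rfl⟩, fun a => ?_⟩⟩
    · rintro _ ⟨ρ, rfl⟩
      simp only [U, ofPred_forall]
      exact isOpen_iInter_of_finite fun a =>
        isOpen_lt ((hcont a).dist continuous_const) continuous_const
    · rw [dist_self]
      positivity
  have h0 : coverEntropyOf A.additiveMap (range U) < (δ : EReal) :=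
    ((coverEntropyOf_le _ hU).trans_eq hA).trans_lt (by exact_mod_cast hδ)
  filter_upwards [eventually_lt_of_limsup_lt h0, eventually_ge_atTop 1] with n hn hn1
  have hn' := EReal.coe_lt_coe_iff.1 hn
  have hn0 : (0 : ℝ) < n := by exact_mod_cast hn1
  rw [div_lt_iff₀ hn0] at hn'
  obtain ⟨s, h1, h2, h3⟩ :=
    (iterJoin_isOpenCover A.additiveMap.continuous hU n).finCov.exists_card
  choose W hWs hW using fun k => FinCov.exists_mem h2 (A.point (k * n))
  -- The representative of block `k` is the least index with the same chosen cover member. Leastness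
  -- gives `r 0 = 0` and makes `W` injective on representatives, so there are at most as many of
  -- them as members of the subcover.
  have hex : ∀ k, ∃ k', W k' = W k := fun k => ⟨k, rfl⟩
  have hr : ∀ k, W (Nat.find (hex k)) = W k := fun k => Nat.find_spec (hex k)
  have hinj : InjOn W (range fun k => Nat.find (hex k)) := by
    rintro _ ⟨k, rfl⟩ _ ⟨l, rfl⟩ h
    simp only [hr] at h
    simp only [h]
  have hmaps : MapsTo W (range fun k => Nat.find (hex k)) (s : Set (Set A.Spec)) :=
    fun k _ => hWs k
  have hfin : (range fun k => Nat.find (hex k)).Finite :=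
    Finite.of_injOn hmaps hinj s.finite_toSet
  refine ⟨fun k => Nat.find (hex k), (Nat.find_eq_zero _).2 rfl, hfin, ?_, fun k i hi => ?_⟩
  · have hle := ncard_le_ncard_of_injOn W hmaps hinj s.finite_toSet
    rw [ncard_coe_finset, h3] at hle
    have hpos : 0 < (range fun k => Nat.find (hex k)).ncard := (ncard_pos hfin).2 ⟨_, 0, rfl⟩
    exact (Real.log_le_log (by exact_mod_cast hpos) (by exact_mod_cast hle)).trans hn'.le
  · obtain ⟨φ, hφ, hφW⟩ := h1 (hWs k)
    obtain ⟨ρ, hρ⟩ := hφ ⟨i, hi⟩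
    have key : ∀ l, W l = W k → ∀ a, dist (f a (l * n + i)) (ρ ⟨f a, hf a⟩) < ε / 2 := by
      intro l hl a
      have hmem := hW l
      rw [hl, hφW] at hmem
      have hmem' := mem_iInter.1 hmem ⟨i, hi⟩
      rw [← hρ] at hmem'
      have := hmem' a
      rw [A.iterate_additiveMap_apply, Anqie.point_apply] at this
      convert this using 2
      exact (iterate_shift_apply (f a) i (l * n)).symm
    refine (dist_pi_le_iff hε.le).2 fun a => ?_
    have e1 := key k rfl a
    have e2 := key _ (hr k) a
    have := dist_triangle_right (f a (k * n + i)) (f a (Nat.find (hex k) * n + i))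
      (ρ ⟨f a, hf a⟩)
    linarith

/-! ### Block maps and word counts -/

/-- Move the block of length `n` that contains `m` to the block with index `r (m / n)`. -/
def blockMap (n : ℕ) (r : ℕ → ℕ) (m : ℕ) : ℕ := r (m / n) * n + m % n

lemma blockMap_add {n : ℕ} (r : ℕ → ℕ) (k : ℕ) {i : ℕ} (hi : i < n) :
    blockMap n r (k * n + i) = r k * n + i := by
  have h1 : (k * n + i) / n = k := by
    rw [Nat.add_comm, Nat.add_mul_div_right _ _ (by omega), Nat.div_eq_of_lt hi, Nat.zero_add]
  have h2 : (k * n + i) % n = i := by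
    rw [Nat.add_comm, Nat.add_mul_mod_self_right, Nat.mod_eq_of_lt hi]
  rw [blockMap, h1, h2]

lemma blockMap_of_lt {n : ℕ} {r : ℕ → ℕ} (hr : r 0 = 0) {m : ℕ} (hm : m < n) :
    blockMap n r m = m := by
  have := blockMap_add r 0 hm
  rwa [hr, Nat.zero_mul, Nat.zero_add] at this

/-- A block map of length `a * c` moves blocks of length `a` to blocks of length `a`. -/
lemma exists_blockMap_mul (a c : ℕ) (r : ℕ → ℕ) (k : ℕ) :
    ∃ k', ∀ i < a, blockMap (a * c) r (k * a + i) = k' * a + i := by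
  refine ⟨r (k / c) * c + k % c, fun i hi => ?_⟩
  have h1 : (k * a + i) / a = k := by
    rw [Nat.add_comm, Nat.add_mul_div_right _ _ (by omega), Nat.div_eq_of_lt hi, Nat.zero_add]
  have h2 : (k * a + i) % a = i := by
    rw [Nat.add_comm, Nat.add_mul_mod_self_right, Nat.mod_eq_of_lt hi]
  rw [blockMap, ← Nat.div_div_eq_div_mul, Nat.mod_mul, h1, h2]
  ring

/-- If the aligned blocks of length `N` of a sequence take at most `K` values, then it has at most
`N * K ^ (L / N + 2)` words of length `L`. -/
lemma ncard_seqWords_le {F : Type*} {q : ℕ → F} {N : ℕ} (hN : 0 < N) {c : ℕ → ℕ}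
    (hc : (range c).Finite) {D : ℕ → ℕ → F} (hD : ∀ k, ∀ i < N, q (k * N + i) = D (c k) i)
    (L : ℕ) : (seqWords q L).ncard ≤ N * (range c).ncard ^ (L / N + 2) := by
  have : Finite (range c) := hc
  -- A word is recovered from the offset of its start within a block and the codes of the at most `L
  -- / N + 2` blocks it meets. The value `q 0` is never used for actual words.
  let G : Fin N × (Fin (L / N + 2) → range c) → Fin L → F := fun p i =>
    if h : ((p.1 : ℕ) + i) / N < L / N + 2 then D (p.2 ⟨(p.1 + i) / N, h⟩) ((p.1 + i) % N)
    else q 0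
  have hsub : seqWords q L ⊆ range G := by
    rintro _ ⟨m, rfl⟩
    refine ⟨(⟨m % N, Nat.mod_lt _ hN⟩, fun t => ⟨c (m / N + t), ⟨_, rfl⟩⟩), funext fun i => ?_⟩
    have hlt : (m % N + i) / N < L / N + 2 := by
      have h1 : m % N + i ≤ L + N := by
        have := Nat.mod_lt m hN
        omega
      have h2 := Nat.div_le_div_right (c := N) h1
      rw [Nat.add_div_right _ hN] at h2
      omega
    simp only [G, dif_pos hlt]
    rw [← hD _ _ (Nat.mod_lt _ hN)]
    congr 1
    have e1 := Nat.div_add_mod m N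
    have e2 := Nat.div_add_mod (m % N + i) N
    rw [Nat.add_mul, Nat.mul_comm (m / N), Nat.mul_comm ((m % N + i) / N)]
    omega
  calc (seqWords q L).ncard ≤ (range G).ncard := ncard_le_ncard hsub (toFinite _)
    _ ≤ Nat.card (Fin N × (Fin (L / N + 2) → range c)) := by
      rw [← image_univ, ← ncard_univ]
      exact ncard_image_le
    _ = N * (range c).ncard ^ (L / N + 2) := by
      rw [Nat.card_prod, Nat.card_fun]
      simp [Nat.card_coe_set_eq]

/-- For each rate a single block length suffices: a word of length `L` costs about `L / N` codes of
logarithmic size at most `δ * N` each, and the choice of offset and the two boundary blocks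
contribute a bounded amount. -/
lemma subexpComplexity_of_blocks {F : Type*} {q : ℕ → F}
    (h : ∀ δ : ℝ, 0 < δ → ∃ N : ℕ, 0 < N ∧ ∃ c : ℕ → ℕ, (range c).Finite ∧
      Real.log (range c).ncard ≤ δ * N ∧
      ∃ D : ℕ → ℕ → F, ∀ k, ∀ i < N, q (k * N + i) = D (c k) i) : SubexpComplexity q := by
  intro δ hδ
  obtain ⟨N, hN, c, hc, hcN, D, hD⟩ := h (δ / 2) (by positivity)
  have hN' : (0 : ℝ) < N := by exact_mod_cast hN
  -- With codes at rate `δ / 2`, the remaining half must absorb `log N` and the boundary term `2 *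
  -- (δ / 2 * N)`.
  have hbig := tendsto_natCast_atTop_atTop (R := ℝ) |>.eventually_ge_atTop
    ((Real.log N + δ * N) / (δ / 2))
  filter_upwards [hbig] with L hL
  rw [div_le_iff₀ (by positivity)] at hL
  have hK : 0 < (range c).ncard := (ncard_pos hc).2 ⟨_, 0, rfl⟩
  rcases Nat.eq_zero_or_pos (seqWords q L).ncard with h0 | h0
  · rw [h0]
    simp only [Nat.cast_zero, Real.log_zero]
    positivity
  have hdiv : ((L / N : ℕ) : ℝ) * N ≤ L := by exact_mod_cast Nat.div_mul_le_self L N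
  calc Real.log (seqWords q L).ncard
      ≤ Real.log ((N * (range c).ncard ^ (L / N + 2) : ℕ) : ℝ) :=
        Real.log_le_log (by exact_mod_cast h0) (by exact_mod_cast ncard_seqWords_le hN hc hD L)
    _ = Real.log N + ((L / N : ℕ) + 2) * Real.log (range c).ncard := by
        push_cast
        rw [Real.log_mul hN'.ne' (by positivity), Real.log_pow]
        push_cast
        ring
    _ ≤ Real.log N + ((L / N : ℕ) + 2) * (δ / 2 * N) := by gcongr
    _ ≤ δ * L := by nlinarith

/-! ### Composing block maps over all scales -/

/-- The composition `blockMap (n 0) (r 0) ∘ ⋯ ∘ blockMap (n (J - 1)) (r (J - 1))`. -/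
def blockComp (n : ℕ → ℕ) (r : ℕ → ℕ → ℕ) : ℕ → ℕ → ℕ
  | 0 => id
  | J + 1 => blockComp n r J ∘ blockMap (n J) (r J)

section BlockComp

variable {n : ℕ → ℕ} {r : ℕ → ℕ → ℕ}

/-- Since `r j 0 = 0`, each map of scale at least `n J` fixes the initial block containing `m`.
Hence the compositions stabilize at every index. -/
lemma blockComp_eq_of_lt (hn : StrictMono n) (hr : ∀ j, r j 0 = 0) {m J J' : ℕ} (hm : m < n J)
    (hJ : J ≤ J') : blockComp n r J' m = blockComp n r J m := by
  induction J', hJ using Nat.le_induction with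
  | base => rfl
  | succ J' hJ ih =>
    rw [blockComp, Function.comp_apply,
      blockMap_of_lt (hr J') (hm.trans_le (hn.monotone hJ)), ih]

/-- The coarser maps act first and, by divisibility, carry the block to another aligned block of
length `n j`; the map at scale `j` then sends it to a representative. So the content depends only on
a value of `r j`, however many coarser maps are composed. -/
lemma exists_blockComp_block (hdvd : ∀ i j, i ≤ j → n i ∣ n j) {j J : ℕ} (hJ : j + 1 ≤ J)
    (k : ℕ) :
    ∃ k', ∀ i < n j, blockComp n r J (k * n j + i) = blockComp n r j (r j k' * n j + i) := by
  induction J, hJ using Nat.le_induction generalizing k with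
  | base => exact ⟨k, fun i hi => congrArg (blockComp n r j) (blockMap_add (r j) k hi)⟩
  | succ J hJ ih =>
    obtain ⟨c, hc⟩ := hdvd j J (by omega)
    obtain ⟨k₁, h₁⟩ := exists_blockMap_mul (n j) c (r J) k
    obtain ⟨k', h'⟩ := ih k₁
    refine ⟨k', fun i hi => ?_⟩
    rw [blockComp, Function.comp_apply, hc, h₁ i hi, h' i hi]

lemma dist_blockComp_le {E : Type*} [PseudoMetricSpace E] {f : ℕ → E} {ε : ℕ → ℝ}
    (h : ∀ j m, dist (f m) (f (blockMap (n j) (r j) m)) ≤ ε j) (J m : ℕ) :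
    dist (f m) (f (blockComp n r J m)) ≤ ∑ j ∈ Finset.range J, ε j := by
  induction J generalizing m with
  | zero => simp [blockComp]
  | succ J ih =>
    rw [Finset.sum_range_succ, add_comm (∑ j ∈ Finset.range J, ε j)]
    exact (dist_triangle _ _ _).trans (add_le_add (h J m)
      (ih (blockMap (n J) (r J) m)))

end BlockComp

/-- A sequence whose long blocks have few approximate representatives is uniformly close to its
composition with a finite-valued sequence of subexponential complexity. -/
lemma exists_finite_range_approx {E : Type*} [PseudoMetricSpace E] {f : ℕ → E}
    (h : ∀ ε δ : ℝ, 0 < ε → 0 < δ → ∀ᶠ n : ℕ in atTop, ∃ r : ℕ → ℕ, r 0 = 0 ∧ (range r).Finite ∧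
      Real.log (range r).ncard ≤ δ * n ∧
      ∀ k, ∀ i < n, dist (f (k * n + i)) (f (r k * n + i)) ≤ ε) {ε : ℝ} (hε : 0 < ε) :
    ∃ q : ℕ → ℕ, (range q).Finite ∧ SubexpComplexity q ∧ ∀ m, dist (f m) (f (q m)) ≤ ε := by
  -- The errors `e j` are positive with sum at most `ε`, so they may be spent at all scales at once.
  obtain ⟨e, he, s, hs, hsε⟩ := posSumOfEncodable hε ℕ
  choose N hN using fun j : ℕ => eventually_atTop.1 (h (e j) (1 / (j + 1)) (he j) (by positivity))
  -- The factors `N i + 2` give divisibility, strict growth (each is at least `2`) and `n j ≥ N j`.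
  let n : ℕ → ℕ := fun j => ∏ i ∈ Finset.range (j + 1), (N i + 2)
  have hsucc : ∀ j, n (j + 1) = n j * (N (j + 1) + 2) := fun j => Finset.prod_range_succ _ _
  have hpos : ∀ j, 0 < n j := fun j => Finset.prod_pos fun i _ => by omega
  have hmono : StrictMono n := strictMono_nat_of_lt_succ fun j => by
    rw [hsucc]
    have := hpos j
    nlinarith
  have hdvd : ∀ i j, i ≤ j → n i ∣ n j := fun i j hij =>
    Finset.prod_dvd_prod_of_subset _ _ _ (Finset.range_mono (by omega))
  have hge : ∀ j, N j ≤ n j := fun j => by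
    have : N j + 2 ∣ n j := Finset.dvd_prod_of_mem _ (by simp)
    have := Nat.le_of_dvd (hpos j) this
    omega
  choose r hr0 hrfin hrcard hrdist using fun j => hN j (n j) (hge j)
  have hlt : ∀ m, m < n (m + 1) := fun m => hmono.le_apply (x := m + 1)
  -- As `m < n (m + 1)`, this is the stable value of the compositions at `m`.
  let q : ℕ → ℕ := fun m => blockComp n r (m + 1) m
  have hblock : ∀ j k, ∃ k', ∀ i < n j, q (k * n j + i) = blockComp n r j (r j k' * n j + i) := by
    intro j k
    -- One composition must serve the whole block: `(k + 1) * n j` exceeds each of its indices, and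
    -- `j + 1` ensures that the map at scale `j` takes part.
    obtain ⟨k', hk'⟩ :=
      exists_blockComp_block (r := r) hdvd (le_max_left (j + 1) ((k + 1) * n j)) k
    refine ⟨k', fun i hi => Eq.trans ?_ (hk' i hi)⟩
    refine (blockComp_eq_of_lt hmono hr0 (hlt _) ((Nat.succ_le_of_lt ?_).trans
      (le_max_right _ _))).symm
    rw [Nat.add_mul, Nat.one_mul]
    omega
  refine ⟨q, ?_, subexpComplexity_of_blocks fun δ hδ => ?_, fun m => ?_⟩
  -- At scale `0` the remaining composition is the identity, so all values of `q` lie in the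
  -- finitely many representative blocks.
  · refine (((hrfin 0).prod (finite_Iio (n 0))).image
      fun p => blockComp n r 0 (p.1 * n 0 + p.2)).subset ?_
    rintro _ ⟨m, rfl⟩
    obtain ⟨k', hk'⟩ := hblock 0 (m / n 0)
    have hmod := Nat.mod_lt m (hpos 0)
    refine ⟨(r 0 k', m % n 0), ⟨⟨k', rfl⟩, hmod⟩, ?_⟩
    exact (hk' _ hmod).symm.trans (by rw [Nat.div_add_mod'])
  · obtain ⟨j, hj⟩ := exists_nat_one_div_lt hδ
    choose b hb using hblock j
    have hsub : (range fun k => r j (b k)) ⊆ range (r j) := range_subset_iff.2 fun k => ⟨_, rfl⟩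
    have hfin := (hrfin j).subset hsub
    have hcard : 0 < (range fun k => r j (b k)).ncard := (ncard_pos hfin).2 ⟨_, 0, rfl⟩
    refine ⟨n j, hpos j, fun k => r j (b k), hfin, ?_,
      fun a i => blockComp n r j (a * n j + i), hb⟩
    calc Real.log (range fun k => r j (b k)).ncard ≤ Real.log (range (r j)).ncard :=
          Real.log_le_log (by exact_mod_cast hcard)
            (by exact_mod_cast ncard_le_ncard hsub (hrfin j))
      _ ≤ 1 / (j + 1) * n j := hrcard j
      _ ≤ δ * n j := by gcongr
  · have hmap : ∀ j m, dist (f m) (f (blockMap (n j) (r j) m)) ≤ e j := fun j m => by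
      have := hrdist j (m / n j) (m % n j) (Nat.mod_lt _ (hpos j))
      rwa [Nat.div_add_mod'] at this
    refine (dist_blockComp_le hmap (m + 1) m).trans (le_trans ?_ hsε)
    exact sum_le_hasSum _ (fun i _ => (he i).le) hs

/-! ### Unitaries with a gap in the spectrum -/

open Pointwise in
/-- A unitary whose spectrum is not the whole circle is connected to `1`. -/
lemma Unitary.joined_one_of_notMem_spectrum {B : Type*} [CStarAlgebra B] (v : unitary B)
    {z : Circle} (hz : (z : ℂ) ∉ spectrum ℂ (v : B)) : Joined v 1 := by
  let c : Circle → unitary B := fun w => ⟨(w : ℂ) • (v : B), Unitary.mem_iff.2 (by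
    simp [smul_smul, ← Circle.coe_inv_eq_conj])⟩
  have hc : Continuous c := (Continuous.smul (by fun_prop) continuous_const).subtype_mk _
  -- Rotation by `-z⁻¹` moves the missing point `z` to `-1`. The rotated unitary is then at distance
  -- less than `2` from `1`, and the rotation itself is a path of unitaries parametrized by the
  -- angle.
  obtain ⟨θ, hθ⟩ := Circle.exp_surjective (-z⁻¹)
  have h1 : Joined v (c (-z⁻¹)) := by
    have : Joined (c (Circle.exp 0)) (c (Circle.exp θ)) :=
      ((PathConnectedSpace.joined (0 : ℝ) θ).map Circle.exp.continuous).map hc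
    have h0 : c (Circle.exp 0) = v := Subtype.ext (by simp [c])
    rwa [h0, hθ] at this
  refine h1.trans (Unitary.joined 1 (c (-z⁻¹)) ?_).symm
  rw [OneMemClass.coe_one, Unitary.norm_sub_one_lt_two_iff (c (-z⁻¹)).2]
  have h2 : (-1 : ℂ) = Circle.toUnits (-z⁻¹) • (z : ℂ) := by simp [Units.smul_def]
  change -1 ∉ spectrum ℂ (Circle.toUnits (-z⁻¹) • (v : B))
  rwa [h2, spectrum.smul_mem_smul_iff]

/-- By spectral mapping, every point of the spectrum is a root of `p`. -/
lemma spectrum_finite_of_aeval_eq_zero {B : Type*} [Ring B] [Algebra ℂ B] (a : B)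
    {p : Polynomial ℂ} (hp : p ≠ 0) (ha : Polynomial.aeval a p = 0) :
    (spectrum ℂ a).Finite := by
  nontriviality B
  refine p.roots.toFinset.finite_toSet.subset fun z hz => ?_
  have := spectrum.subset_polynomial_aeval a p ⟨z, hz, rfl⟩
  rw [ha, spectrum.zero_eq, mem_singleton_iff] at this
  simpa [hp] using this

lemma Unitary.joined_one_of_aeval_eq_zero {B : Type*} [CStarAlgebra B] (v : unitary B)
    {p : Polynomial ℂ} (hp : p ≠ 0) (hv : Polynomial.aeval (v : B) p = 0) : Joined v 1 := by
  -- A finite circle would be discrete, and being connected it would be a point, contrary to `-1 ≠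
  -- 1`.
  have hinf : (range ((↑) : Circle → ℂ)).Infinite := by
    have : Infinite Circle := not_finite_iff_infinite.1 fun _ =>
      Circle.neg_ne_self 1 (PreconnectedSpace.trivial_of_discrete.elim _ _)
    exact infinite_range_of_injective (α := Circle) Circle.coe_injective
  obtain ⟨_, ⟨z, rfl⟩, hz⟩ :=
    (hinf.sdiff (spectrum_finite_of_aeval_eq_zero (v : B) hp hv)).nonempty
  exact Unitary.joined_one_of_notMem_spectrum v hz

/-! ### Pointwise evaluation of matrices -/

/-- The entrywise evaluation at `n` of matrices over a subalgebra of `l^∞(ℕ)`. -/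
noncomputable def evalMatrix (S : StarSubalgebra ℂ LInf) (k n : ℕ) :
    CStarMatrix (Fin k) (Fin k) S →ₐ[ℂ] Matrix (Fin k) (Fin k) ℂ :=
  ((evalHom n).comp S.subtype.toAlgHom).mapMatrix.comp
    (CStarMatrix.ofMatrixStarAlgEquiv (n := Fin k) (A := S)).symm.toAlgEquiv.toAlgHom

section evalMatrix

variable {S : StarSubalgebra ℂ LInf} {k : ℕ}

lemma evalMatrix_star (n : ℕ) (M : CStarMatrix (Fin k) (Fin k) S) :
    evalMatrix S k n (star M) = star (evalMatrix S k n M) := rfl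

/-- Reduces unitarity and polynomial identities over `S` to complex matrices, one `n` at a time. -/
lemma evalMatrix_ext {M N : CStarMatrix (Fin k) (Fin k) S}
    (h : ∀ n, evalMatrix S k n M = evalMatrix S k n N) : M = N := by
  ext i j
  exact LInf.ext fun n => congrFun (congrFun (h n) i) j

end evalMatrix

/-- Composition of a bounded function with a sequence of indices. -/
def LInf.comp (f : LInf) (q : ℕ → ℕ) : LInf :=
  (⟨fun n => f (q n), memℓp_infty <| by
    obtain ⟨C, hC⟩ := memℓp_infty_iff.1 f.2
    exact ⟨C, by rintro _ ⟨n, rfl⟩; exact hC ⟨q n, rfl⟩⟩⟩ : lp (fun _ : ℕ => ℂ) ∞)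

lemma LInf.dist_le {f g : LInf} {C : ℝ} (hC : 0 ≤ C) (h : ∀ n, dist (f n) (g n) ≤ C) :
    dist f g ≤ C := by
  rw [dist_eq_norm]
  refine lp.norm_le_of_forall_le hC fun n => ?_
  exact (dist_eq_norm (f n) (g n)).symm.trans_le (h n)

/-! ### Homotopies of unitary matrices -/

section UnitaryMatrix

variable {A : Type*} [CStarAlgebra A] {k : ℕ}

/-- Unitary matrices with close entries are homotopic. -/
lemma exists_uHomotopic_of_dist_le (u : UMat A k) :
    ∃ δ > 0, ∀ v : UMat A k, (∀ i j, dist (v.1 i j) (u.1 i j) ≤ δ) → UHomotopic u v := by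
  -- The C*-algebra structure on matrices over `A` asks for a star order on `A`; the spectral order
  -- provides one.
  let _ := CStarAlgebra.spectralOrder A
  let _ := CStarAlgebra.spectralOrderedRing A
  have hc : Continuous fun M : Fin k → Fin k → A => CStarMatrix.ofMatrix (Matrix.of M) :=
    CStarMatrix.uniformEmbedding_ofMatrix.uniformContinuous.continuous
  -- Entrywise closeness controls the matrix norm, and unitaries at distance less than `2` are
  -- joined.
  obtain ⟨δ, hδ, h⟩ := Metric.continuous_iff.1 hc u.1 2 two_pos
  refine ⟨δ / 2, by positivity, fun v hv => uHomotopic_iff_joined.2 (Unitary.joined u v ?_)⟩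
  rw [← dist_eq_norm]
  refine h v.1 (lt_of_le_of_lt ?_ (half_lt_self hδ))
  exact (dist_pi_le_iff (by positivity)).2 fun i => (dist_pi_le_iff (by positivity)).2 (hv i)

/-- A unitary matrix that is annihilated by a polynomial is homotopic to the identity. -/
lemma uHomotopic_one_of_aeval_eq_zero (v : UMat A k) {p : Polynomial ℂ} (hp : p ≠ 0)
    (hv : Polynomial.aeval v.1 p = 0) : UHomotopic v 1 := by
  let _ := CStarAlgebra.spectralOrder A
  let _ := CStarAlgebra.spectralOrderedRing A
  exact uHomotopic_iff_joined.2 (Unitary.joined_one_of_aeval_eq_zero v hp hv)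

end UnitaryMatrix

/-! ### Triviality of the unitary homotopy classes -/

/-- Every unitary matrix over `ℰ₀(ℕ)` is homotopic to the identity. -/
lemma uHomotopic_one (k : ℕ) (u : UMat E0 k) : UHomotopic u 1 := by
  let f : Fin k × Fin k → LInf := fun a => (u.1 a.1 a.2 : LInf)
  -- The entries are treated as one family because the same `q` must serve all of them.
  have hA : Anqie.entropyOf (range f) = 0 := Anqie.entropyOf_eq_zero_of_mem (by
    rintro _ ⟨a, rfl⟩
    exact (u.1 a.1 a.2).2)
  obtain ⟨ε, hε, hball⟩ := exists_uHomotopic_of_dist_le u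
  obtain ⟨q, hqfin, hq, hdist⟩ := exists_finite_range_approx (f := fun m a => f a m)
    (fun ε δ hε hδ => exists_block_representatives hA f
      (fun a => Anqie.subset_generated _ ⟨a, rfl⟩) hε hδ) hε
  let V : CStarMatrix (Fin k) (Fin k) E0 := fun i j =>
    ⟨(u.1 i j : LInf).comp q, entropyOf_comp_eq_zero hqfin hq (fun n => (u.1 i j : LInf) n) _
      fun _ => rfl⟩
  have hV : ∀ n, evalMatrix E0 k n V = evalMatrix E0 k (q n) u.1 := fun n => rfl
  have hVu : V ∈ unitary (CStarMatrix (Fin k) (Fin k) E0) := by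
    refine Unitary.mem_iff.2 ⟨evalMatrix_ext fun n => ?_, evalMatrix_ext fun n => ?_⟩
    · rw [map_mul, evalMatrix_star, hV, ← evalMatrix_star, ← map_mul,
        Unitary.star_mul_self_of_mem u.2, map_one, map_one]
    · rw [map_mul, evalMatrix_star, hV, ← evalMatrix_star, ← map_mul,
        Unitary.mul_star_self_of_mem u.2, map_one, map_one]
  have hclose : UHomotopic u ⟨V, hVu⟩ := hball _ fun i j => LInf.dist_le hε.le fun n => by
    rw [dist_comm]
    exact (dist_le_pi_dist (fun a => f a n) (fun a => f a (q n)) (i, j)).trans (hdist n)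
  -- By Cayley–Hamilton each value of `V` is annihilated by its own characteristic polynomial;
  -- finiteness of the range of `q` allows one common multiple.
  let p : Polynomial ℂ := ∏ a ∈ hqfin.toFinset, (evalMatrix E0 k a u.1).charpoly
  have hp : p ≠ 0 := Finset.prod_ne_zero_iff.2 fun a _ => (Matrix.charpoly_monic _).ne_zero
  have hpV : Polynomial.aeval V p = 0 := by
    refine evalMatrix_ext fun n => ?_
    have hdvd : (evalMatrix E0 k (q n) u.1).charpoly ∣ p :=
      Finset.dvd_prod_of_mem _ (hqfin.mem_toFinset.2 ⟨n, rfl⟩)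
    rw [← Polynomial.aeval_algHom_apply, hV, map_zero]
    exact Polynomial.aeval_eq_zero_of_dvd_aeval_eq_zero hdvd (Matrix.aeval_self_charpoly _)
  exact uHomotopic_iff_joined.2 ((uHomotopic_iff_joined.1 hclose).trans
    (uHomotopic_iff_joined.1 (uHomotopic_one_of_aeval_eq_zero ⟨V, hVu⟩ hp hpV)))

theorem mainTheorem2 :
    Subsingleton (K1 E0) ∧ ∀ (k : ℕ) (u : UMat E0 k), UHomotopic u 1 := by
  refine ⟨⟨fun x y => ?_⟩, uHomotopic_one⟩
  induction x using Quotient.inductionOn with | _ u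
  induction y using Quotient.inductionOn with | _ v
  refine Quotient.sound ⟨max u.1 v.1, le_max_left _ _, le_max_right _ _, ?_⟩
  exact uHomotopic_iff_joined.2 ((uHomotopic_iff_joined.1 (uHomotopic_one _ _)).trans
    (uHomotopic_iff_joined.1 (uHomotopic_one _ _)).symm)
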